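/- Let $N,n,n_0\ge 1$, $A\in\mathbb R^{n\times n}$ and $C_i\in\mathbb R^{m_i\times n}$, $i=1,\dots,N$, be such that the pair $(C,A)$ with $C=\mathrm{col}(C_1,\dots,C_N)$ is observable, i.e. the matrix $\mathrm{col}(C,CA,\dots,CA^{n-1})$ has rank $n$. For each $i$ let $U_i\in\mathbb R^{n\times\nu_i}$ be a matrix whose columns form an orthonormal basis of the unobservable subspace $\ker\,\mathrm{col}(C_i,C_iA,\dots,C_iA^{n-1})$ of $(C_i,A)$, put $\nu=\sum_{i=1}^N\nu_i$ and $U=\text{block diag}\{U_1,\dots,U_N\}\in\mathbb R^{Nn\times\nu}$. For $p=1,\dots,n_0$ let $\mathcal G_p$ be an undirected graph on the nodes $\{1,\dots,N\}$ without self-loops, with a symmetric nonnegative weighted adjacency matrix $[a^p_{ij}]$ such that $a^p_{ii}=0$ and, for $i\ne j$, $a^p_{ij}>0$ if and only if $(j,i)$ is an edge of $\mathcal G_p$, and let $\mathcal L_p$ be its Laplacian, with diagonal entries $\sum_{j}a^p_{ij}$ and off-diagonal entries $-a^p_{ij}$. Let $\sigma:[0,\infty)\to\{1,\dots,n_0\}$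 be a piecewise constant switching signal with switching instants $0=t_0<t_1<t_2<\cdots$ and dwell time $\tau>0$, i.e. $t_{j+1}-t_j\ge\tau$ and $\sigma$ is constant on $[t_j,t_{j+1})$ for every $j\ge 0$. Suppose that the switching graph is jointly connected: there are a subsequence $\{t_{j_k}\}_{k\ge 0}$ of the switching instants with $t_{j_0}=0$ and a constant $T_c>0$ such that, for every $k\ge 0$, $\tau\le t_{j_{k+1}}-t_{j_k}\le T_c$ and the union graph $\bigcup_{t_j\in[t_{j_k},t_{j_{k+1}})}\mathcal G_{\sigma(t_j)}$ is connected. Then, for every symmetric positive definite matrix $Q\in\mathbb R^{\nu\times\nu}$, the linear switched system $$\dot\eta(t)=-Q\,U^{T}\left(\mathcal L_{\sigma(t)}\otimes I_n\right)U\,\eta(t),\qquad t\ge 0,$$ is exponentially stable: there are constants $c,r>0$ such that, for every $t^*\ge 0$, every solution $\eta$ on $[t^*,\infty)$ satisfies $\|\eta(t)\|\le c\,e^{-r(t-t^*)}\|\eta(t^*)\|$ for all $t\ge t^*$, where $\|\cdot\|$ is the Euclidean norm. -/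

import Mathlib

open scoped Matrix Kronecker

/-- `σ : [0, ∞) → {1, …, n₀}` is a piecewise constant switching signal with switching instants
`t 0 = 0 < t 1 < t 2 < ⋯` and dwell time `τ > 0`.  (Values of `σ` at negative times are never
used.) -/
structure IsSwitchingSignal {n₀ : ℕ} (σ : ℝ → Fin n₀) (t : ℕ → ℝ) (τ : ℝ) : Prop where
  dwell_pos : 0 < τ
  start : t 0 = 0
  dwell : ∀ j, τ ≤ t (j + 1) - t j
  const : ∀ j, ∃ p, ∀ s ∈ Set.Ico (t j) (t (j + 1)), σ s = p

/-- `a` is a weighted adjacency matrix of the undirected graph `G`: a nonnegative symmetric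
matrix with zero diagonal, whose off-diagonal entry `a i j` is positive exactly when there is an
edge from `j` to `i`. -/
structure IsWeightedAdjacency {N : ℕ} (G : SimpleGraph (Fin N)) (a : Matrix (Fin N) (Fin N) ℝ) :
    Prop where
  nonneg : ∀ i j, 0 ≤ a i j
  symm : a.IsSymm
  diag_zero : ∀ i, a i i = 0
  pos_iff : ∀ i j, i ≠ j → (0 < a i j ↔ G.Adj j i)

/-- The Laplacian of a weighted adjacency matrix: `l i i = ∑ k, a i k`, and `l i j = - a i j`
for `i ≠ j`. -/
def weightedLaplacian {N : ℕ} (a : Matrix (Fin N) (Fin N) ℝ) : Matrix (Fin N) (Fin N) ℝ :=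
  Matrix.of fun i j => if i = j then ∑ k, a i k else - a i j

/-- The jointly connected condition for the switching graph `G (σ s)` with switching instants `t`
and dwell time `τ`: along a subsequence `t (j k)` of the switching instants that starts at `0` and
whose gaps lie in `[τ, Tc]`, the union of the graphs over each `[t (j k), t (j (k + 1)))` is
connected. -/
def JointlyConnected {n₀ N : ℕ} (G : Fin n₀ → SimpleGraph (Fin N)) (σ : ℝ → Fin n₀) (t : ℕ → ℝ)
    (τ : ℝ) : Prop :=
  ∃ (j : ℕ → ℕ) (Tc : ℝ), StrictMono j ∧ t (j 0) = 0 ∧ 0 < Tc ∧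
    ∀ k, τ ≤ t (j (k + 1)) - t (j k) ∧ t (j (k + 1)) - t (j k) ≤ Tc ∧
      (⨆ r ∈ {r : ℕ | t r ∈ Set.Ico (t (j k)) (t (j (k + 1)))}, G (σ (t r))).Connected

/-- The observability matrix `col (C, C A, …, C A ^ (n - 1))`. -/
def observabilityMatrix {ι : Type*} {n : ℕ} (C : Matrix ι (Fin n) ℝ)
    (A : Matrix (Fin n) (Fin n) ℝ) : Matrix (Fin n × ι) (Fin n) ℝ :=
  Matrix.of fun p c => (C * A ^ (p.1 : ℕ)) p.2 c

/-- The pair `(C, A)` is observable: its observability matrix has rank `n`. -/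
def IsObservable {ι : Type*} {n : ℕ} (C : Matrix ι (Fin n) ℝ)
    (A : Matrix (Fin n) (Fin n) ℝ) : Prop :=
  (observabilityMatrix C A).rank = n

/-- The stacked output matrix `col (C 1, …, C N)`. -/
def stackedOutput {N n : ℕ} {m : Fin N → ℕ} (C : ∀ i, Matrix (Fin (m i)) (Fin n) ℝ) :
    Matrix (Σ i, Fin (m i)) (Fin n) ℝ :=
  Matrix.of fun p c => C p.1 p.2 c

/-- The columns of `U` form an orthonormal basis of the unobservable subspace of `(C, A)`, the
kernel of the observability matrix. -/
def IsUnobservableBasis {m n ν : ℕ} (C : Matrix (Fin m) (Fin n) ℝ) (A : Matrix (Fin n) (Fin n) ℝ)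
    (U : Matrix (Fin n) (Fin ν) ℝ) : Prop :=
  Uᵀ * U = 1 ∧
    LinearMap.range U.mulVecLin = LinearMap.ker (observabilityMatrix C A).mulVecLin

/-- `block diag (U 1, …, U N)`, an `(N n) × ν` matrix with `ν = ∑ i, ν i`. -/
def blockDiag {N n : ℕ} {ν : Fin N → ℕ} (U : ∀ i, Matrix (Fin n) (Fin (ν i)) ℝ) :
    Matrix (Fin N × Fin n) (Σ i, Fin (ν i)) ℝ :=
  (Matrix.blockDiagonal' U).submatrix (fun p => ⟨p.1, p.2⟩) id

/-- `η` is a (Carathéodory) solution on `[t₀, ∞)` of the linear time-varying system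
`η' (s) = M s η (s)`. -/
def IsLTVSolution {ι : Type*} [Fintype ι] (M : ℝ → Matrix ι ι ℝ) (t₀ : ℝ)
    (η : ℝ → EuclideanSpace ℝ ι) : Prop :=
  ∀ t, t₀ ≤ t →
    IntervalIntegrable (fun s => WithLp.toLp 2 (M s *ᵥ (η s).ofLp) : ℝ → EuclideanSpace ℝ ι)
      MeasureTheory.volume t₀ t ∧
    η t = η t₀ + ∫ s in t₀..t, (WithLp.toLp 2 (M s *ᵥ (η s).ofLp) : EuclideanSpace ℝ ι)

/-- The linear time-varying system `η' (s) = M s η (s)`, `s ≥ 0`, is (uniformly) exponentially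
stable, with the Euclidean norm on the state space. -/
def ExponentiallyStable {ι : Type*} [Fintype ι] (M : ℝ → Matrix ι ι ℝ) : Prop :=
  ∃ c > 0, ∃ r > 0, ∀ t₀ ≥ 0, ∀ η : ℝ → EuclideanSpace ℝ ι, IsLTVSolution M t₀ η →
    ∀ t ≥ t₀, ‖η t‖ ≤ c * Real.exp (-r * (t - t₀)) * ‖η t₀‖

/-!
Write `Q = P Pᴴ` with `P` invertible. In the coordinate `ζ = P⁻¹ η` the system becomes the gradient
flow `ζ' = -S(s) ζ`, with `S = Pᴴ Uᵀ (L ⊗ I) U P` positive semidefinite. Along it `‖ζ‖²` dissipates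
at the rate `2 ⟪S ζ, ζ⟫`, and since `‖S ζ‖² ≤ ‖S‖ ⟪S ζ, ζ⟫`, Cauchy–Schwarz bounds the displacement
over a window by the energy lost there. Hence, if the integral of `⟪S x, x⟫` over every window of a
fixed length is at least `μ ‖x‖²`, each such window costs a fixed fraction of the energy.

For a vector `U x` killed by every Laplacian of a connecting window, the blocks `U i (x i)` all
coincide, so their common value lies in every unobservable subspace and vanishes by observability.
As there are finitely many modes, each active for at least the dwell time, the lower bound holds
with a single `μ`.
-/

open MeasureTheory Set

section Primitive

theorem absolutelyContinuousOnInterval_of_dist_le {X Y : Type*} [PseudoMetricSpace X]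
    [PseudoMetricSpace Y] {f : ℝ → X} {g : ℝ → Y} {a b : ℝ}
    (hg : AbsolutelyContinuousOnInterval g a b)
    (h : ∀ x ∈ uIcc a b, ∀ y ∈ uIcc a b, dist (f x) (f y) ≤ dist (g x) (g y)) :
    AbsolutelyContinuousOnInterval f a b := by
  rw [absolutelyContinuousOnInterval_iff] at hg ⊢
  intro ε hε
  obtain ⟨δ, hδ, hgδ⟩ := hg ε hε
  refine ⟨δ, hδ, fun I hI hlen => lt_of_le_of_lt ?_ (hgδ I hI hlen)⟩
  exact Finset.sum_le_sum fun i hi => h _ (hI.1 i hi).1 _ (hI.1 i hi).2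

variable {E : Type*} [NormedAddCommGroup E]

/-- `η` is on `[t₀, ∞)` an indefinite integral of `f`: the Carathéodory form of `η' = f`. Both
functions are unconstrained before `t₀`. -/
def IsPrimitiveFrom [NormedSpace ℝ E] (f η : ℝ → E) (t₀ : ℝ) : Prop :=
  ∀ t, t₀ ≤ t → IntervalIntegrable f volume t₀ t ∧ η t = η t₀ + ∫ s in t₀..t, f s

namespace IsPrimitiveFrom

variable {f η : ℝ → E} {t₀ a b : ℝ}

section NormedSpace

variable [NormedSpace ℝ E]

theorem intervalIntegrable (h : IsPrimitiveFrom f η t₀) (ha : t₀ ≤ a) (hb : t₀ ≤ b) :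
    IntervalIntegrable f volume a b :=
  (h a ha).1.symm.trans (h b hb).1

theorem sub_eq_integral (h : IsPrimitiveFrom f η t₀) (ha : t₀ ≤ a) (hb : t₀ ≤ b) :
    η b - η a = ∫ s in a..b, f s := by
  rw [(h a ha).2, (h b hb).2, add_sub_add_left_eq_sub,
    intervalIntegral.integral_interval_sub_left (h b hb).1 (h a ha).1]

theorem map {F : Type*} [NormedAddCommGroup F] [NormedSpace ℝ F] [CompleteSpace E]
    [CompleteSpace F] (h : IsPrimitiveFrom f η t₀) (L : E →L[ℝ] F) :
    IsPrimitiveFrom (fun s => L (f s)) (fun s => L (η s)) t₀ := by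
  intro t ht
  obtain ⟨hint, heq⟩ := h t ht
  refine ⟨?_, ?_⟩
  · exact ⟨L.integrable_comp hint.1, L.integrable_comp hint.2⟩
  · rw [L.intervalIntegral_comp_comm hint, ← map_add, ← heq]

theorem absolutelyContinuousOnInterval (h : IsPrimitiveFrom f η t₀) (ha : t₀ ≤ a)
    (hb : t₀ ≤ b) : AbsolutelyContinuousOnInterval η a b := by
  have hIci : ∀ x ∈ uIcc a b, t₀ ≤ x := fun x hx => (le_inf ha hb).trans hx.1
  have hf := (h.intervalIntegrable ha hb).norm
  refine absolutelyContinuousOnInterval_of_dist_le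
    (hf.absolutelyContinuousOnInterval_intervalIntegral left_mem_uIcc) fun x hx y hy => ?_
  rw [dist_eq_norm, dist_eq_norm, h.sub_eq_integral (hIci y hy) (hIci x hx),
    intervalIntegral.integral_interval_sub_left
      (hf.mono_set (uIcc_subset_uIcc left_mem_uIcc hx))
      (hf.mono_set (uIcc_subset_uIcc left_mem_uIcc hy))]
  exact intervalIntegral.norm_integral_le_abs_integral_norm

theorem ae_hasDerivAt [CompleteSpace E] (h : IsPrimitiveFrom f η t₀) (ha : t₀ ≤ a)
    (hab : a ≤ b) : ∀ᵐ x, x ∈ Ioo a b → HasDerivAt η (f x) x := by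
  filter_upwards [(h.intervalIntegrable ha (ha.trans hab)).ae_hasDerivAt_integral] with x hx hxab
  have hint := hx (uIcc_of_le hab ▸ Ioo_subset_Icc_self hxab) a left_mem_uIcc
  refine (hint.const_add (η a)).congr_of_eventuallyEq ?_
  filter_upwards [Ioi_mem_nhds hxab.1] with y hy
  rw [← h.sub_eq_integral ha (ha.trans (mem_Ioi.1 hy).le), add_sub_cancel]

end NormedSpace

theorem norm_sq_sub_norm_sq [InnerProductSpace ℝ E] [CompleteSpace E]
    (h : IsPrimitiveFrom f η t₀) (ha : t₀ ≤ a) (hab : a ≤ b) :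
    IntervalIntegrable (fun s => 2 * inner ℝ (η s) (f s)) volume a b ∧
      ‖η b‖ ^ 2 - ‖η a‖ ^ 2 = ∫ s in a..b, 2 * inner ℝ (η s) (f s) := by
  have hnorm : AbsolutelyContinuousOnInterval (fun s => ‖η s‖) a b :=
    absolutelyContinuousOnInterval_of_dist_le
      (h.absolutelyContinuousOnInterval ha (ha.trans hab)) fun x _ y _ =>
        (dist_norm_norm_le _ _).trans_eq (dist_eq_norm _ _).symm
  have hsq : AbsolutelyContinuousOnInterval (fun s => ‖η s‖ ^ 2) a b := by
    simpa only [pow_two] using hnorm.fun_mul hnorm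
  have hderiv : deriv (fun s => ‖η s‖ ^ 2) =ᵐ[volume.restrict (uIoc a b)]
      fun s => 2 * inner ℝ (η s) (f s) := by
    rw [uIoc_of_le hab, ← restrict_Ioo_eq_restrict_Ioc, Filter.EventuallyEq,
      ae_restrict_iff' measurableSet_Ioo]
    filter_upwards [h.ae_hasDerivAt ha hab] with x hx hxab
    exact (hx hxab).norm_sq.deriv
  refine ⟨hsq.intervalIntegrable_deriv.congr_ae hderiv, ?_⟩
  rw [← hsq.integral_deriv_eq_sub]
  exact intervalIntegral.integral_congr_ae_restrict hderiv

end IsPrimitiveFrom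

end Primitive

theorem sq_intervalIntegral_le {g : ℝ → ℝ} {a b : ℝ} (hab : a ≤ b)
    (hg : IntervalIntegrable g volume a b)
    (hg2 : IntervalIntegrable (fun s => g s ^ 2) volume a b) :
    (∫ s in a..b, g s) ^ 2 ≤ (b - a) * ∫ s in a..b, g s ^ 2 := by
  rcases hab.eq_or_lt with rfl | hlt
  · simp
  set I := ∫ s in a..b, g s
  have hnonneg : 0 ≤ ∫ s in a..b, ((b - a) * g s - I) ^ 2 :=
    intervalIntegral.integral_nonneg hab fun s _ => sq_nonneg _
  have hexpand : ∫ s in a..b, ((b - a) * g s - I) ^ 2 =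
      (b - a) * ((b - a) * (∫ s in a..b, g s ^ 2) - I ^ 2) := by
    have hpt : ∀ s, ((b - a) * g s - I) ^ 2 =
        (b - a) ^ 2 * g s ^ 2 - 2 * (b - a) * I * g s + I ^ 2 := fun s => by ring
    simp only [hpt]
    rw [intervalIntegral.integral_add ((hg2.const_mul _).sub (hg.const_mul _))
        intervalIntegrable_const,
      intervalIntegral.integral_sub (hg2.const_mul _) (hg.const_mul _),
      intervalIntegral.integral_const_mul, intervalIntegral.integral_const_mul,
      intervalIntegral.integral_const, smul_eq_mul]
    ring
  rw [hexpand] at hnonneg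
  exact sub_nonneg.1 (nonneg_of_mul_nonneg_right hnonneg (sub_pos.2 hlt))

section PositiveOperator

variable {E : Type*} [NormedAddCommGroup E] [InnerProductSpace ℝ E] {S : E →L[ℝ] E}

theorem norm_apply_sq_le_of_isPositive (hS : S.IsPositive) (x : E) :
    ‖S x‖ ^ 2 ≤ ‖S‖ * inner ℝ (S x) x := by
  have hcs : inner ℝ (S x) (S x) ^ 2 ≤ inner ℝ (S x) x * inner ℝ (S (S x)) (S x) := by
    have h := LinearMap.BilinForm.apply_mul_apply_le_of_forall_zero_le
      (innerₗ E ∘ₗ (S : E →ₗ[ℝ] E)) hS.inner_nonneg_left x (S x)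
    simpa [hS.inner_left_eq_inner_right (S x) x, pow_two] using h
  have hle : inner ℝ (S (S x)) (S x) ≤ ‖S‖ * ‖S x‖ ^ 2 := by
    calc inner ℝ (S (S x)) (S x) ≤ ‖S (S x)‖ * ‖S x‖ := real_inner_le_norm _ _
      _ ≤ ‖S‖ * ‖S x‖ * ‖S x‖ := by gcongr; exact S.le_opNorm _
      _ = ‖S‖ * ‖S x‖ ^ 2 := by ring
  rcases (sq_nonneg ‖S x‖).eq_or_lt with h0 | hpos
  · rw [← h0]
    exact mul_nonneg (norm_nonneg _) (hS.inner_nonneg_left x)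
  · rw [real_inner_self_eq_norm_sq] at hcs
    refine le_of_mul_le_mul_right ?_ hpos
    nlinarith [mul_le_mul_of_nonneg_left hle (hS.inner_nonneg_left x)]

theorem inner_apply_le_two_mul_add_of_isPositive (hS : S.IsPositive) (x y : E) :
    inner ℝ (S x) x ≤ 2 * inner ℝ (S y) y + 2 * inner ℝ (S (x - y)) (x - y) := by
  have hsym : inner ℝ (S y) x = inner ℝ (S x) y := by
    rw [hS.inner_left_eq_inner_right y x, real_inner_comm]
  have h := hS.inner_nonneg_left (x - (2 : ℝ) • y)
  simp only [map_sub, map_smul, inner_sub_left, inner_sub_right, inner_smul_left,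
    inner_smul_right, RCLike.conj_to_real] at h ⊢
  linarith [hsym]

end PositiveOperator

section GradientFlow

variable {E : Type*} [NormedAddCommGroup E] [InnerProductSpace ℝ E]

/-- `η` is on `[t₀, ∞)` a Carathéodory solution of `η' = -S(s) η`, the gradient flow of the
time-varying quadratic potential `⟪S(s) x, x⟫ / 2` when every `S s` is positive. -/
def IsGradientFlow (S : ℝ → E →L[ℝ] E) (η : ℝ → E) (t₀ : ℝ) : Prop :=
  IsPrimitiveFrom (fun s => -S s (η s)) η t₀

/-- Persistent excitation, the classical condition under which `η' = -S(s) η` forgets its initial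
state: on every window of a fixed length `T` the averaged quadratic form of `S` is bounded below.
A non-integrable form has integral `0`, so for `x ≠ 0` the bound includes integrability. -/
def IsPersistentlyExciting (S : ℝ → E →L[ℝ] E) : Prop :=
  ∃ T > 0, ∃ μ > 0, ∀ a ≥ 0, ∀ x, μ * ‖x‖ ^ 2 ≤ ∫ s in a..a + T, inner ℝ (S s x) x

namespace IsGradientFlow

variable [CompleteSpace E] {S : ℝ → E →L[ℝ] E} {η : ℝ → E} {t₀ a b K : ℝ}

theorem norm_sq_sub_norm_sq (hη : IsGradientFlow S η t₀) (ha : t₀ ≤ a) (hab : a ≤ b) :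
    IntervalIntegrable (fun s => inner ℝ (S s (η s)) (η s)) volume a b ∧
      ‖η a‖ ^ 2 - ‖η b‖ ^ 2 = 2 * ∫ s in a..b, inner ℝ (S s (η s)) (η s) := by
  obtain ⟨hint, hsub⟩ := IsPrimitiveFrom.norm_sq_sub_norm_sq hη ha hab
  have hform : ∀ s, inner ℝ (S s (η s)) (η s) = -(1 / 2) * (2 * inner ℝ (η s) (-S s (η s))) :=
    fun s => by rw [inner_neg_right, real_inner_comm]; ring
  simp only [hform]
  refine ⟨hint.const_mul _, ?_⟩
  rw [intervalIntegral.integral_const_mul, ← hsub]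
  ring

theorem norm_le_norm (hη : IsGradientFlow S η t₀) (hS : ∀ s, (S s).IsPositive) (ha : t₀ ≤ a)
    (hab : a ≤ b) : ‖η b‖ ≤ ‖η a‖ := by
  have hdiss := (hη.norm_sq_sub_norm_sq ha hab).2
  have hnonneg : 0 ≤ ∫ s in a..b, inner ℝ (S s (η s)) (η s) :=
    intervalIntegral.integral_nonneg hab fun s _ => (hS s).inner_nonneg_left _
  exact le_of_sq_le_sq (by linarith) (norm_nonneg _)

theorem norm_sub_sq_le (hη : IsGradientFlow S η t₀) (hS : ∀ s, (S s).IsPositive)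
    (hK : ∀ s, ‖S s‖ ≤ K) (ha : t₀ ≤ a) (hab : a ≤ b) :
    ‖η b - η a‖ ^ 2 ≤ (b - a) * (K * ∫ s in a..b, inner ℝ (S s (η s)) (η s)) := by
  have hint := (IsPrimitiveFrom.intervalIntegrable hη ha (ha.trans hab)).norm
  have hform := (hη.norm_sq_sub_norm_sq ha hab).1.const_mul K
  have hpt : ∀ s, ‖-S s (η s)‖ ^ 2 ≤ K * inner ℝ (S s (η s)) (η s) := fun s => by
    rw [norm_neg]
    exact (norm_apply_sq_le_of_isPositive (hS s) _).trans
      (mul_le_mul_of_nonneg_right (hK s) ((hS s).inner_nonneg_left _))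
  have hint2 : IntervalIntegrable (fun s => ‖-S s (η s)‖ ^ 2) volume a b :=
    hform.mono_fun' (hint.def'.aestronglyMeasurable.pow 2) <|
      Filter.Eventually.of_forall fun s => by
        simpa only [Real.norm_eq_abs, abs_sq] using hpt s
  calc ‖η b - η a‖ ^ 2 = ‖∫ s in a..b, -S s (η s)‖ ^ 2 := by
        rw [IsPrimitiveFrom.sub_eq_integral hη ha (ha.trans hab)]
    _ ≤ (∫ s in a..b, ‖-S s (η s)‖) ^ 2 := by
        gcongr
        exact intervalIntegral.norm_integral_le_integral_norm hab
    _ ≤ (b - a) * ∫ s in a..b, ‖-S s (η s)‖ ^ 2 := sq_intervalIntegral_le hab hint hint2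
    _ ≤ (b - a) * ∫ s in a..b, K * inner ℝ (S s (η s)) (η s) := by
        gcongr
        exact intervalIntegral.integral_mono_on hab hint2 hform fun s _ => hpt s
    _ = (b - a) * (K * ∫ s in a..b, inner ℝ (S s (η s)) (η s)) := by
        rw [intervalIntegral.integral_const_mul]

/-- The state moves little over a window that dissipates little energy, so the form of `S` at the
frozen state `η a` is controlled by the dissipation along the moving state. -/
theorem integral_inner_apply_le (hη : IsGradientFlow S η t₀) (hS : ∀ s, (S s).IsPositive)
    (hK : ∀ s, ‖S s‖ ≤ K) (ha : t₀ ≤ a) (hab : a ≤ b) :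
    ∫ s in a..b, inner ℝ (S s (η a)) (η a) ≤
      (1 + (K * (b - a)) ^ 2) * (‖η a‖ ^ 2 - ‖η b‖ ^ 2) := by
  obtain ⟨hint, hdiss⟩ := hη.norm_sq_sub_norm_sq ha hab
  have hK0 : 0 ≤ K := (norm_nonneg _).trans (hK 0)
  set J := ∫ s in a..b, inner ℝ (S s (η s)) (η s)
  have hdrift : ∀ s ∈ Ioc a b, ‖η a - η s‖ ^ 2 ≤ (b - a) * (K * J) := by
    intro s hs
    rw [norm_sub_rev]
    refine (hη.norm_sub_sq_le hS hK ha hs.1.le).trans ?_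
    have hmono : ∫ r in a..s, inner ℝ (S r (η r)) (η r) ≤ J :=
      intervalIntegral.integral_mono_interval le_rfl hs.1.le hs.2
        (Filter.Eventually.of_forall fun r => (hS r).inner_nonneg_left _) hint
    have hnonneg : 0 ≤ ∫ r in a..s, inner ℝ (S r (η r)) (η r) :=
      intervalIntegral.integral_nonneg hs.1.le fun r _ => (hS r).inner_nonneg_left _
    gcongr
    exact hs.2
  have hpt : ∀ s ∈ Ioc a b, inner ℝ (S s (η a)) (η a) ≤
      2 * inner ℝ (S s (η s)) (η s) + 2 * (K * ((b - a) * (K * J))) := by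
    intro s hs
    refine (inner_apply_le_two_mul_add_of_isPositive (hS s) _ (η s)).trans ?_
    gcongr
    calc inner ℝ (S s (η a - η s)) (η a - η s) ≤ ‖S s‖ * ‖η a - η s‖ * ‖η a - η s‖ :=
          (real_inner_le_norm _ _).trans (by gcongr; exact (S s).le_opNorm _)
      _ = ‖S s‖ * ‖η a - η s‖ ^ 2 := by ring
      _ ≤ K * ((b - a) * (K * J)) := by gcongr; exacts [hK s, hdrift s hs]
  calc ∫ s in a..b, inner ℝ (S s (η a)) (η a)
      ≤ ∫ s in a..b, (2 * inner ℝ (S s (η s)) (η s) + 2 * (K * ((b - a) * (K * J)))) := by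
        rw [intervalIntegral.integral_of_le hab, intervalIntegral.integral_of_le hab]
        refine integral_mono_of_nonneg
          (Filter.Eventually.of_forall fun s => (hS s).inner_nonneg_left _)
          ((hint.const_mul 2).add intervalIntegrable_const).1 ?_
        exact (ae_restrict_iff' measurableSet_Ioc).2 (Filter.Eventually.of_forall hpt)
    _ = (1 + (K * (b - a)) ^ 2) * (‖η a‖ ^ 2 - ‖η b‖ ^ 2) := by
        rw [intervalIntegral.integral_add (hint.const_mul 2) intervalIntegrable_const,
          intervalIntegral.integral_const_mul, intervalIntegral.integral_const, smul_eq_mul, hdiss]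
        ring

theorem norm_add_le_mul_norm {T μ : ℝ} (hη : IsGradientFlow S η t₀)
    (hS : ∀ s, (S s).IsPositive) (hK : ∀ s, ‖S s‖ ≤ K) (ha : t₀ ≤ a) (hT : 0 ≤ T) (hμ : 0 ≤ μ)
    (hexc : μ * ‖η a‖ ^ 2 ≤ ∫ s in a..a + T, inner ℝ (S s (η a)) (η a)) :
    ‖η (a + T)‖ ≤ √((1 + (K * T) ^ 2) / (1 + (K * T) ^ 2 + μ)) * ‖η a‖ := by
  have haT : a ≤ a + T := le_add_of_nonneg_right hT
  have hloss := hexc.trans (hη.integral_inner_apply_le hS hK ha haT)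
  rw [add_sub_cancel_left] at hloss
  set W := 1 + (K * T) ^ 2
  have hW : 0 < W := by positivity
  have hWμ : 0 < W + μ := add_pos_of_pos_of_nonneg hW hμ
  have hmono : μ * ‖η (a + T)‖ ^ 2 ≤ μ * ‖η a‖ ^ 2 := by
    gcongr
    exact hη.norm_le_norm hS ha haT
  refine le_of_sq_le_sq ?_ (by positivity)
  rw [mul_pow, Real.sq_sqrt (div_pos hW hWμ).le, div_mul_eq_mul_div, le_div_iff₀ hWμ]
  linarith

end IsGradientFlow

theorem le_exp_of_contraction {V : ℝ → ℝ} {ρ T t₀ : ℝ} (hρ : 0 < ρ) (hρ1 : ρ < 1) (hT : 0 < T)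
    (hV : AntitoneOn V (Ici t₀)) (hV0 : 0 ≤ V t₀) (hc : ∀ a ≥ t₀, V (a + T) ≤ ρ * V a) {t : ℝ}
    (ht : t₀ ≤ t) : V t ≤ ρ⁻¹ * Real.exp (-(-Real.log ρ / T) * (t - t₀)) * V t₀ := by
  have hwindow : ∀ i : ℕ, t₀ ≤ t₀ + i * T := fun i =>
    le_add_of_nonneg_right (mul_nonneg i.cast_nonneg hT.le)
  have hpow : ∀ i : ℕ, V (t₀ + i * T) ≤ ρ ^ i * V t₀ := by
    intro i
    induction i with
    | zero => simp
    | succ i ih =>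
      calc V (t₀ + (i + 1 : ℕ) * T) = V (t₀ + i * T + T) := by push_cast; ring_nf
        _ ≤ ρ * V (t₀ + i * T) := hc _ (hwindow i)
        _ ≤ ρ * (ρ ^ i * V t₀) := by gcongr
        _ = ρ ^ (i + 1) * V t₀ := by ring
  set x := (t - t₀) / T with hx
  have hx0 : 0 ≤ x := div_nonneg (sub_nonneg.2 ht) hT.le
  have hfloor : t₀ + ⌊x⌋₊ * T ≤ t := by
    have := (le_div_iff₀ hT).1 (Nat.floor_le hx0)
    linarith
  have hexp : ρ ^ ⌊x⌋₊ ≤ ρ⁻¹ * Real.exp (-(-Real.log ρ / T) * (t - t₀)) := by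
    calc ρ ^ ⌊x⌋₊ = ρ ^ (⌊x⌋₊ : ℝ) := (Real.rpow_natCast _ _).symm
      _ ≤ ρ ^ (x - 1) := Real.rpow_le_rpow_of_exponent_ge hρ hρ1.le (Nat.sub_one_lt_floor x).le
      _ = ρ⁻¹ * Real.exp (-(-Real.log ρ / T) * (t - t₀)) := by
        rw [Real.rpow_sub_one hρ.ne', Real.rpow_def_of_pos hρ, div_eq_inv_mul, hx]
        ring_nf
  calc V t ≤ V (t₀ + ⌊x⌋₊ * T) := hV (hwindow _) ht hfloor
    _ ≤ ρ ^ ⌊x⌋₊ * V t₀ := hpow _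
    _ ≤ ρ⁻¹ * Real.exp (-(-Real.log ρ / T) * (t - t₀)) * V t₀ := by gcongr

theorem IsPersistentlyExciting.exists_norm_le_exp [CompleteSpace E] {S : ℝ → E →L[ℝ] E} {K : ℝ}
    (hexc : IsPersistentlyExciting S) (hS : ∀ s, (S s).IsPositive) (hK : ∀ s, ‖S s‖ ≤ K) :
    ∃ c > 0, ∃ r > 0, ∀ t₀ ≥ 0, ∀ η : ℝ → E, IsGradientFlow S η t₀ →
      ∀ t ≥ t₀, ‖η t‖ ≤ c * Real.exp (-r * (t - t₀)) * ‖η t₀‖ := by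
  obtain ⟨T, hT, μ, hμ, hlb⟩ := hexc
  set ρ := √((1 + (K * T) ^ 2) / (1 + (K * T) ^ 2 + μ))
  have hρ : 0 < ρ := Real.sqrt_pos.2 (by positivity)
  have hρ1 : ρ < 1 := by
    rw [Real.sqrt_lt' one_pos, one_pow, div_lt_one (by positivity)]
    exact lt_add_of_pos_right _ hμ
  refine ⟨ρ⁻¹, inv_pos.2 hρ, -Real.log ρ / T, div_pos (neg_pos.2 (Real.log_neg hρ hρ1)) hT, ?_⟩
  intro t₀ ht₀ η hη t ht
  exact le_exp_of_contraction (V := fun s => ‖η s‖) hρ hρ1 hT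
    (fun a ha b _ hab => hη.norm_le_norm hS ha hab) (norm_nonneg _)
    (fun a ha => hη.norm_add_le_mul_norm hS hK ha hT.le hμ.le (hlb a (ht₀.trans ha) _)) ht

end GradientFlow

section Coercivity

variable {E : Type*} [NormedAddCommGroup E] [InnerProductSpace ℝ E] [FiniteDimensional ℝ E]

theorem exists_mul_norm_sq_le_inner_of_isPositive {S : E →L[ℝ] E} (hS : S.IsPositive)
    (hker : ∀ x, S x = 0 → x = 0) : ∃ μ > 0, ∀ x, μ * ‖x‖ ^ 2 ≤ inner ℝ (S x) x := by
  obtain ⟨L, -, hL⟩ := LinearMap.exists_antilipschitzWith (S : E →ₗ[ℝ] E)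
    (LinearMap.ker_eq_bot'.2 hker)
  refine ⟨((L : ℝ) ^ 2 * ‖S‖ + 1)⁻¹, by positivity, fun x => ?_⟩
  rw [inv_mul_le_iff₀ (by positivity)]
  have hnonneg := hS.inner_nonneg_left x
  calc ‖x‖ ^ 2 ≤ (L * ‖S x‖) ^ 2 := by
        gcongr
        exact hL.le_mul_norm (map_zero _) x
    _ = L ^ 2 * ‖S x‖ ^ 2 := mul_pow _ _ _
    _ ≤ L ^ 2 * (‖S‖ * inner ℝ (S x) x) := by
        gcongr
        exact norm_apply_sq_le_of_isPositive hS x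
    _ ≤ (L ^ 2 * ‖S‖ + 1) * inner ℝ (S x) x := by linarith

theorem exists_mul_norm_sq_le_sum_inner {κ : Type*} [Finite κ] {S : κ → E →L[ℝ] E}
    (hS : ∀ p, (S p).IsPositive) :
    ∃ μ > 0, ∀ F : Finset κ, (∀ x, (∀ p ∈ F, S p x = 0) → x = 0) →
      ∀ x, μ * ‖x‖ ^ 2 ≤ ∑ p ∈ F, inner ℝ (S p x) x := by
  have hF : ∀ F : Finset κ, ∃ μ > 0, (∀ x, (∀ p ∈ F, S p x = 0) → x = 0) →
      ∀ x, μ * ‖x‖ ^ 2 ≤ ∑ p ∈ F, inner ℝ (S p x) x := by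
    intro F
    by_cases hker : ∀ x, (∀ p ∈ F, S p x = 0) → x = 0
    · have hpos := ContinuousLinearMap.isPositive_sum F fun p _ => hS p
      have happly : ∀ x, inner ℝ ((∑ p ∈ F, S p) x) x = ∑ p ∈ F, inner ℝ (S p x) x :=
        fun x => by rw [sum_apply, sum_inner]
      obtain ⟨μ, hμ, hle⟩ := exists_mul_norm_sq_le_inner_of_isPositive hpos fun x hx => by
        refine hker x fun p hp => ?_
        have hsum : ∑ p ∈ F, inner ℝ (S p x) x = 0 := by rw [← happly, hx, inner_zero_left]
        have hzero := (Finset.sum_eq_zero_iff_of_nonneg fun p _ =>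
          (hS p).inner_nonneg_left x).1 hsum p hp
        have hsq := norm_apply_sq_le_of_isPositive (hS p) x
        rw [hzero, mul_zero] at hsq
        exact norm_eq_zero.1 (pow_eq_zero_iff two_ne_zero |>.1 (hsq.antisymm (sq_nonneg _)))
      exact ⟨μ, hμ, fun _ x => happly x ▸ hle x⟩
    · exact ⟨1, one_pos, fun h => absurd h hker⟩
  choose μ hμ hle using hF
  obtain ⟨F₀, hF₀⟩ := Finite.exists_min μ
  refine ⟨μ F₀, hμ F₀, fun F hker x => le_trans ?_ (hle F hker x)⟩
  gcongr
  exact hF₀ F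

end Coercivity

theorem exists_le_lt_succ_of_forall_le_sub {s : ℕ → ℝ} {δ x : ℝ} (hδ : 0 < δ)
    (hs : ∀ k, δ ≤ s (k + 1) - s k) (hx : s 0 ≤ x) : ∃ k, s k ≤ x ∧ x < s (k + 1) := by
  have hlin : ∀ k : ℕ, s 0 + k * δ ≤ s k := by
    intro k
    induction k with
    | zero => simp
    | succ k ih => push_cast; linarith [hs k]
  have hex : ∃ k, x < s (k + 1) := by
    obtain ⟨k, hk⟩ := exists_nat_gt ((x - s 0) / δ)
    exact ⟨k, by linarith [(div_lt_iff₀ hδ).1 hk, hlin k, hs k]⟩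
  classical
  refine ⟨Nat.find hex, ?_, Nat.find_spec hex⟩
  rcases hk : Nat.find hex with _ | k
  · exact hx
  · exact not_lt.1 (Nat.find_min hex (hk ▸ Nat.lt_succ_self k))

namespace IsSwitchingSignal

variable {n₀ : ℕ} {σ : ℝ → Fin n₀} {t : ℕ → ℝ} {τ : ℝ}

theorem strictMono (hσ : IsSwitchingSignal σ t τ) : StrictMono t :=
  strictMono_nat_of_lt_succ fun k => by linarith [hσ.dwell k, hσ.dwell_pos]

theorem eq_of_mem_Ico (hσ : IsSwitchingSignal σ t τ) {r : ℕ} {s : ℝ}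
    (hs : s ∈ Ico (t r) (t (r + 1))) : σ s = σ (t r) := by
  obtain ⟨p, hp⟩ := hσ.const r
  rw [hp s hs, hp (t r) ⟨le_rfl, hs.1.trans_lt hs.2⟩]

theorem intervalIntegrable_succ (hσ : IsSwitchingSignal σ t τ) (g : Fin n₀ → ℝ) (r : ℕ) :
    IntervalIntegrable (fun s => g (σ s)) volume (t r) (t (r + 1)) := by
  refine (intervalIntegrable_const (c := g (σ (t r)))).congr_uIoo fun s hs => ?_
  rw [uIoo_of_lt (hσ.strictMono r.lt_succ_self)] at hs
  exact congrArg g (hσ.eq_of_mem_Ico (Ioo_subset_Ico_self hs)).symm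

theorem intervalIntegrable (hσ : IsSwitchingSignal σ t τ) (g : Fin n₀ → ℝ) {a b : ℝ}
    (ha : 0 ≤ a) (hb : 0 ≤ b) : IntervalIntegrable (fun s => g (σ s)) volume a b := by
  have hfrom : ∀ x, 0 ≤ x → IntervalIntegrable (fun s => g (σ s)) volume 0 x := by
    intro x hx
    obtain ⟨k, -, hk⟩ := exists_le_lt_succ_of_forall_le_sub hσ.dwell_pos hσ.dwell
      (hσ.start.trans_le hx)
    have hiter := IntervalIntegrable.trans_iterate (n := k + 1) fun r _ =>
      hσ.intervalIntegrable_succ g r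
    rw [hσ.start] at hiter
    exact hiter.mono_set (uIcc_subset_uIcc left_mem_uIcc (mem_uIcc_of_le hx hk.le))
  exact (hfrom a ha).symm.trans (hfrom b hb)

theorem mul_sum_le_integral (hσ : IsSwitchingSignal σ t τ) {g : Fin n₀ → ℝ} (hg : ∀ p, 0 ≤ g p)
    {m n : ℕ} (hmn : m ≤ n) :
    τ * ∑ r ∈ Finset.Ico m n, g (σ (t r)) ≤ ∫ s in t m..t n, g (σ s) := by
  rw [← intervalIntegral.sum_integral_adjacent_intervals_Ico hmn fun r _ =>
    hσ.intervalIntegrable_succ g r, Finset.mul_sum]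
  refine Finset.sum_le_sum fun r _ => ?_
  calc τ * g (σ (t r)) ≤ (t (r + 1) - t r) * g (σ (t r)) :=
        mul_le_mul_of_nonneg_right (hσ.dwell r) (hg _)
    _ = ∫ _ in t r..t (r + 1), g (σ (t r)) := by
        rw [intervalIntegral.integral_const, smul_eq_mul]
    _ = ∫ s in t r..t (r + 1), g (σ s) :=
        intervalIntegral.integral_congr_Ioo_of_le (hσ.strictMono r.lt_succ_self).le fun s hs =>
          congrArg g (hσ.eq_of_mem_Ico (Ioo_subset_Ico_self hs)).symm

theorem le_sub_of_lt (hσ : IsSwitchingSignal σ t τ) {m n : ℕ} (hmn : m < n) : τ ≤ t n - t m := by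
  linarith [hσ.dwell m, hσ.strictMono.monotone (Nat.succ_le_of_lt hmn)]

theorem isPersistentlyExciting {E : Type*} [NormedAddCommGroup E] [InnerProductSpace ℝ E]
    [FiniteDimensional ℝ E] (hσ : IsSwitchingSignal σ t τ) {S : Fin n₀ → E →L[ℝ] E}
    (hS : ∀ p, (S p).IsPositive) {j : ℕ → ℕ} {T : ℝ} (hj : StrictMono j) (hj0 : t (j 0) = 0)
    (hgap : ∀ k, t (j (k + 1)) - t (j k) ≤ T)
    (hker : ∀ k x, (∀ r ∈ Finset.Ico (j k) (j (k + 1)), S (σ (t r)) x = 0) → x = 0) :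
    IsPersistentlyExciting fun s => S (σ s) := by
  classical
  obtain ⟨μ, hμ, hcoer⟩ := exists_mul_norm_sq_le_sum_inner hS
  have hsucc : ∀ k, j k < j (k + 1) := fun k => hj k.lt_succ_self
  have hT : 0 < T := hσ.dwell_pos.trans_le ((hσ.le_sub_of_lt (hsucc 0)).trans (hgap 0))
  refine ⟨2 * T, by positivity, τ * μ, mul_pos hσ.dwell_pos hμ, fun a ha x => ?_⟩
  have hform : ∀ p, 0 ≤ inner ℝ (S p x) x := fun p => (hS p).inner_nonneg_left x
  obtain ⟨k, hka, hak⟩ := exists_le_lt_succ_of_forall_le_sub (s := fun k => t (j k)) hσ.dwell_pos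
    (fun k => hσ.le_sub_of_lt (hsucc k)) (hj0.trans_le ha)
  have hle : t (j (k + 1)) ≤ t (j (k + 2)) := hσ.strictMono.monotone (hsucc (k + 1)).le
  have hend : t (j (k + 2)) ≤ a + 2 * T := by linarith [hgap k, hgap (k + 1)]
  have hint : IntervalIntegrable (fun s => inner ℝ (S (σ s) x) x) volume a (a + 2 * T) :=
    hσ.intervalIntegrable (fun p => inner ℝ (S p x) x) ha (by linarith)
  set I := Finset.Ico (j (k + 1)) (j (k + 2))
  calc τ * μ * ‖x‖ ^ 2 = τ * (μ * ‖x‖ ^ 2) := mul_assoc _ _ _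
    _ ≤ τ * ∑ p ∈ I.image fun r => σ (t r), inner ℝ (S p x) x := by
        refine mul_le_mul_of_nonneg_left (hcoer _ (fun y hy => ?_) x) hσ.dwell_pos.le
        exact hker (k + 1) y fun r hr => hy _ (Finset.mem_image_of_mem _ hr)
    _ ≤ τ * ∑ r ∈ I, inner ℝ (S (σ (t r)) x) x := by
        refine mul_le_mul_of_nonneg_left ?_ hσ.dwell_pos.le
        exact Finset.sum_image_le_of_nonneg fun p _ => hform p
    _ ≤ ∫ s in t (j (k + 1))..t (j (k + 2)), inner ℝ (S (σ s) x) x :=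
        hσ.mul_sum_le_integral hform (hsucc (k + 1)).le
    _ ≤ ∫ s in a..a + 2 * T, inner ℝ (S (σ s) x) x :=
        intervalIntegral.integral_mono_interval hak.le hle hend
          (Filter.Eventually.of_forall fun s => hform (σ s)) hint

end IsSwitchingSignal

section LTV

variable {ι : Type*} [Fintype ι]

theorem isPositive_toEuclideanCLM [DecidableEq ι] {M : Matrix ι ι ℝ} (hM : M.PosSemidef) :
    (Matrix.toEuclideanCLM (𝕜 := ℝ) M).IsPositive := by
  rw [← ContinuousLinearMap.isPositive_toLinearMap_iff,
    Matrix.coe_toEuclideanCLM_eq_toEuclideanLin]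
  exact Matrix.isPositive_toEuclideanLin_iff.2 hM

theorem mulVec_mulVec_eq_zero_of_posSemidef {κ : Type*} [Fintype κ] {M : Matrix ι ι ℝ}
    (hM : M.PosSemidef) {B : Matrix ι κ ℝ} {x : κ → ℝ} (hx : (Bᴴ * M * B) *ᵥ x = 0) :
    M *ᵥ B *ᵥ x = 0 := by
  refine (hM.dotProduct_mulVec_zero_iff _).1 ?_
  rw [Matrix.star_mulVec, ← Matrix.dotProduct_mulVec, Matrix.mulVec_mulVec, Matrix.mulVec_mulVec,
    hx, dotProduct_zero]

open scoped MatrixOrder in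
theorem exists_isUnit_mul_conjTranspose_of_posDef [DecidableEq ι] {Q : Matrix ι ι ℝ}
    (hQ : Q.PosDef) : ∃ P : Matrix ι ι ℝ, IsUnit P ∧ Q = P * Pᴴ := by
  obtain ⟨B, hB⟩ := CStarAlgebra.nonneg_iff_eq_mul_star_self.1 hQ.posSemidef.nonneg
  exact ⟨B, isUnit_of_mul_isUnit_left (hB ▸ hQ.isUnit), hB⟩

theorem IsLTVSolution.map_inv [DecidableEq ι] {M : ℝ → Matrix ι ι ℝ} {P : Matrix ι ι ℝ}
    (hP : IsUnit P) {t₀ : ℝ} {η : ℝ → EuclideanSpace ℝ ι} (hη : IsLTVSolution M t₀ η) :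
    IsLTVSolution (fun s => P⁻¹ * M s * P) t₀
      fun s => Matrix.toEuclideanCLM (𝕜 := ℝ) P⁻¹ (η s) := by
  have hdet := P.isUnit_iff_isUnit_det.1 hP
  have hmap := IsPrimitiveFrom.map hη (Matrix.toEuclideanCLM (𝕜 := ℝ) P⁻¹)
  have hrhs : ∀ s, Matrix.toEuclideanCLM (𝕜 := ℝ) P⁻¹ (WithLp.toLp 2 (M s *ᵥ (η s).ofLp)) =
      WithLp.toLp 2 ((P⁻¹ * M s * P) *ᵥ
        (Matrix.toEuclideanCLM (𝕜 := ℝ) P⁻¹ (η s)).ofLp) := by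
    intro s
    rw [Matrix.toEuclideanCLM_toLp, Matrix.ofLp_toEuclideanCLM, Matrix.mulVec_mulVec,
      Matrix.mulVec_mulVec, Matrix.mul_nonsing_inv_cancel_right _ _ hdet]
  simp only [hrhs] at hmap
  exact hmap

theorem ExponentiallyStable.of_conj [DecidableEq ι] {M : ℝ → Matrix ι ι ℝ} {P : Matrix ι ι ℝ}
    (hP : IsUnit P) (h : ExponentiallyStable fun s => P⁻¹ * M s * P) : ExponentiallyStable M := by
  have hdet := P.isUnit_iff_isUnit_det.1 hP
  obtain ⟨c, hc, r, hr, hstab⟩ := h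
  set L := Matrix.toEuclideanCLM (𝕜 := ℝ) P
  set L' := Matrix.toEuclideanCLM (𝕜 := ℝ) P⁻¹
  have hinv : ∀ x, L (L' x) = x := fun x => by
    rw [← mul_apply_eq_comp, ← map_mul, Matrix.mul_nonsing_inv _ hdet, map_one,
      one_apply_eq_self]
  obtain ⟨K, hK, hL⟩ := L.bound
  obtain ⟨K', hK', hL'⟩ := L'.bound
  refine ⟨K * c * K', by positivity, r, hr, fun t₀ ht₀ η hη t ht => ?_⟩
  calc ‖η t‖ = ‖L (L' (η t))‖ := by rw [hinv]
    _ ≤ K * ‖L' (η t)‖ := hL _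
    _ ≤ K * (c * Real.exp (-r * (t - t₀)) * ‖L' (η t₀)‖) := by
        gcongr
        exact hstab t₀ ht₀ _ (hη.map_inv hP) t ht
    _ ≤ K * (c * Real.exp (-r * (t - t₀)) * (K' * ‖η t₀‖)) := by
        gcongr
        exact hL' _
    _ = K * c * K' * Real.exp (-r * (t - t₀)) * ‖η t₀‖ := by ring

theorem IsPersistentlyExciting.exponentiallyStable_neg [DecidableEq ι] {S : ℝ → Matrix ι ι ℝ}
    (hexc : IsPersistentlyExciting fun s => Matrix.toEuclideanCLM (𝕜 := ℝ) (S s))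
    (hS : ∀ s, (S s).PosSemidef) {K : ℝ} (hK : ∀ s, ‖Matrix.toEuclideanCLM (𝕜 := ℝ) (S s)‖ ≤ K) :
    ExponentiallyStable fun s => -S s := by
  obtain ⟨c, hc, r, hr, hdecay⟩ :=
    hexc.exists_norm_le_exp (fun s => isPositive_toEuclideanCLM (hS s)) hK
  refine ⟨c, hc, r, hr, fun t₀ ht₀ η hη => hdecay t₀ ht₀ η ?_⟩
  simp only [IsLTVSolution, Matrix.neg_mulVec, WithLp.toLp_neg] at hη
  exact hη

theorem IsSwitchingSignal.exponentiallyStable_neg_mul {n₀ : ℕ} {σ : ℝ → Fin n₀} {t : ℕ → ℝ}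
    {τ : ℝ} (hσ : IsSwitchingSignal σ t τ) {Q : Matrix ι ι ℝ} (hQ : Q.PosDef)
    {H : Fin n₀ → Matrix ι ι ℝ} (hH : ∀ p, (H p).PosSemidef) {j : ℕ → ℕ} {T : ℝ}
    (hj : StrictMono j) (hj0 : t (j 0) = 0) (hgap : ∀ k, t (j (k + 1)) - t (j k) ≤ T)
    (hker : ∀ k x, (∀ r ∈ Finset.Ico (j k) (j (k + 1)), H (σ (t r)) *ᵥ x = 0) → x = 0) :
    ExponentiallyStable fun s => -(Q * H (σ s)) := by
  classical
  obtain ⟨P, hP, rfl⟩ := exists_isUnit_mul_conjTranspose_of_posDef hQ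
  have hdet := P.isUnit_iff_isUnit_det.1 hP
  have hS : ∀ p, (Pᴴ * H p * P).PosSemidef := fun p => (hH p).conjTranspose_mul_mul_same P
  refine ExponentiallyStable.of_conj hP ?_
  have hconj : ∀ s, P⁻¹ * -(P * Pᴴ * H (σ s)) * P = -(Pᴴ * H (σ s) * P) := fun s => by
    rw [Matrix.mul_neg, Matrix.neg_mul, Matrix.mul_assoc P,
      Matrix.nonsing_inv_mul_cancel_left _ _ hdet]
  simp only [hconj]
  let S : Fin n₀ → EuclideanSpace ℝ ι →L[ℝ] EuclideanSpace ℝ ι := fun p =>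
    Matrix.toEuclideanCLM (𝕜 := ℝ) (Pᴴ * H p * P)
  have hexc : IsPersistentlyExciting fun s => S (σ s) := by
    refine hσ.isPersistentlyExciting (fun p => isPositive_toEuclideanCLM (hS p)) hj hj0 hgap
      fun k x hx => (WithLp.ofLp_eq_zero 2).1 ?_
    have hPx : P *ᵥ x.ofLp = 0 := hker k _ fun r hr => by
      refine mulVec_mulVec_eq_zero_of_posSemidef (hH _) ?_
      rw [← Matrix.ofLp_toEuclideanCLM]
      exact congrArg WithLp.ofLp (hx r hr)
    exact Matrix.mulVec_injective_iff_isUnit.2 hP (hPx.trans (Matrix.mulVec_zero P).symm)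
  obtain ⟨K, hK⟩ := (finite_range fun p => ‖S p‖).bddAbove
  exact hexc.exponentiallyStable_neg (fun s => hS (σ s)) fun s => hK (mem_range_self (σ s))

end LTV

section Laplacian

variable {N : ℕ} {G : SimpleGraph (Fin N)} {a : Matrix (Fin N) (Fin N) ℝ}

theorem weightedLaplacian_mulVec (ha : ∀ i, a i i = 0) (y : Fin N → ℝ) (i : Fin N) :
    (weightedLaplacian a *ᵥ y) i = ∑ j, a i j * (y i - y j) := by
  have hentry : ∀ j, weightedLaplacian a i j = (if i = j then ∑ k, a i k else 0) - a i j := by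
    intro j
    by_cases hij : i = j
    · subst hij; simp [weightedLaplacian, ha]
    · simp [weightedLaplacian, hij]
  simp only [Matrix.mulVec, dotProduct, hentry, sub_mul, ite_mul, zero_mul,
    Finset.sum_sub_distrib, Finset.sum_ite_eq, Finset.mem_univ, if_true, mul_sub, Finset.sum_mul]

namespace IsWeightedAdjacency

theorem two_mul_dotProduct_weightedLaplacian (ha : IsWeightedAdjacency G a) (y : Fin N → ℝ) :
    2 * (y ⬝ᵥ weightedLaplacian a *ᵥ y) = ∑ i, ∑ j, a i j * (y i - y j) ^ 2 := by
  have hrow : y ⬝ᵥ weightedLaplacian a *ᵥ y = ∑ i, ∑ j, a i j * (y i * (y i - y j)) := by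
    simp only [dotProduct, weightedLaplacian_mulVec ha.diag_zero, Finset.mul_sum,
      mul_left_comm (y _)]
  have hcol : y ⬝ᵥ weightedLaplacian a *ᵥ y = ∑ i, ∑ j, a i j * (y j * (y j - y i)) := by
    rw [hrow, Finset.sum_comm]
    simp only [ha.symm.apply]
  rw [two_mul]
  nth_rw 1 [hrow]
  rw [hcol]
  simp only [← Finset.sum_add_distrib]
  exact Finset.sum_congr rfl fun i _ => Finset.sum_congr rfl fun j _ => by ring

theorem mul_sub_sq_nonneg (ha : IsWeightedAdjacency G a) (y : Fin N → ℝ) (i j : Fin N) :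
    0 ≤ a i j * (y i - y j) ^ 2 :=
  mul_nonneg (ha.nonneg i j) (sq_nonneg _)

theorem posSemidef_weightedLaplacian (ha : IsWeightedAdjacency G a) :
    (weightedLaplacian a).PosSemidef := by
  refine .of_dotProduct_mulVec_nonneg ?_ fun y => ?_
  · ext i j
    by_cases hij : i = j
    · subst hij; simp
    · simp [weightedLaplacian, hij, Ne.symm hij, ha.symm.apply i j]
  · have hsum : 0 ≤ ∑ i, ∑ j, a i j * (y i - y j) ^ 2 :=
      Finset.sum_nonneg fun i _ => Finset.sum_nonneg fun j _ => ha.mul_sub_sq_nonneg y i j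
    rw [star_trivial]
    linarith [ha.two_mul_dotProduct_weightedLaplacian y]

theorem eq_of_adj (ha : IsWeightedAdjacency G a) {y : Fin N → ℝ}
    (hy : weightedLaplacian a *ᵥ y = 0) {i j : Fin N} (hij : G.Adj i j) : y i = y j := by
  have hsum : ∑ i, ∑ j, a i j * (y i - y j) ^ 2 = 0 := by
    rw [← ha.two_mul_dotProduct_weightedLaplacian, hy, dotProduct_zero, mul_zero]
  have hrow := (Finset.sum_eq_zero_iff_of_nonneg fun i _ =>
    Finset.sum_nonneg fun j _ => ha.mul_sub_sq_nonneg y i j).1 hsum i (Finset.mem_univ i)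
  have hterm := (Finset.sum_eq_zero_iff_of_nonneg fun j _ =>
    ha.mul_sub_sq_nonneg y i j).1 hrow j (Finset.mem_univ j)
  have hpos : 0 < a i j := (ha.pos_iff i j hij.ne).2 hij.symm
  exact sub_eq_zero.1 (pow_eq_zero_iff two_ne_zero |>.1 ((mul_eq_zero.1 hterm).resolve_left
    hpos.ne'))

end IsWeightedAdjacency

end Laplacian

section JointKernel

theorem eq_of_connected_iSup {V κ α : Type*} {G : κ → SimpleGraph V} {R : Set κ}
    (hG : (⨆ r ∈ R, G r).Connected) {f : V → α}
    (hf : ∀ r ∈ R, ∀ u v, (G r).Adj u v → f u = f v) (u v : V) : f u = f v := by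
  obtain ⟨walk⟩ := hG.preconnected u v
  induction walk with
  | nil => rfl
  | cons hadj _ ih =>
    simp only [SimpleGraph.iSup_adj] at hadj
    obtain ⟨r, hr, hadj⟩ := hadj
    exact (hf r hr _ _ hadj).trans ih

theorem kronecker_one_mulVec {l m n R : Type*} [Fintype m] [Fintype n] [DecidableEq n]
    [NonAssocSemiring R] (M : Matrix l m R) (x : m × n → R) (i : l) (c : n) :
    ((M ⊗ₖ (1 : Matrix n n R)) *ᵥ x) (i, c) = (M *ᵥ fun k => x (k, c)) i := by
  simp [Matrix.mulVec, dotProduct, Fintype.sum_prod_type, Matrix.kroneckerMap_apply,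
    Matrix.one_apply]

variable {N n : ℕ} {ν : Fin N → ℕ}

theorem blockDiag_mulVec (U : ∀ i, Matrix (Fin n) (Fin (ν i)) ℝ) (x : (Σ i, Fin (ν i)) → ℝ)
    (i : Fin N) (c : Fin n) : (blockDiag U *ᵥ x) (i, c) = (U i *ᵥ fun l => x ⟨i, l⟩) c := by
  simp only [Matrix.mulVec, dotProduct, Fintype.sum_sigma]
  rw [Fintype.sum_eq_single i fun k hk => Finset.sum_eq_zero fun l _ => ?_]
  · simp [blockDiag]
  · simp [blockDiag, Matrix.blockDiagonal'_apply_ne U c l hk.symm]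

theorem eq_zero_of_weightedLaplacian_mulVec_blockDiag {κ : Type*} {R : Set κ}
    {G : κ → SimpleGraph (Fin N)} {a : κ → Matrix (Fin N) (Fin N) ℝ}
    (ha : ∀ r, IsWeightedAdjacency (G r) (a r)) (hconn : (⨆ r ∈ R, G r).Connected)
    {U : ∀ i, Matrix (Fin n) (Fin (ν i)) ℝ} (hinj : ∀ i, Function.Injective (U i).mulVec)
    (hinf : ⨅ i, LinearMap.range (U i).mulVecLin = ⊥) {x : (Σ i, Fin (ν i)) → ℝ}
    (hx : ∀ r ∈ R, (weightedLaplacian (a r) ⊗ₖ (1 : Matrix (Fin n) (Fin n) ℝ)) *ᵥ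
      blockDiag U *ᵥ x = 0) : x = 0 := by
  set z : Fin N → Fin n → ℝ := fun i => U i *ᵥ fun l => x ⟨i, l⟩
  have hconst : ∀ i k, z i = z k := eq_of_connected_iSup hconn fun r hr u v huv => by
    ext c
    refine (ha r).eq_of_adj (y := fun i => z i c) ?_ huv
    ext i
    have hentry := congrFun (hx r hr) (i, c)
    simp only [kronecker_one_mulVec, blockDiag_mulVec] at hentry
    exact hentry
  have hzero : ∀ i, z i = 0 := fun i => by
    rw [← Submodule.mem_bot ℝ, ← hinf, Submodule.mem_iInf]
    exact fun k => ⟨_, hconst k i⟩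
  ext ⟨i, l⟩
  exact congrFun (hinj i ((hzero i).trans (Matrix.mulVec_zero _).symm)) l

end JointKernel

section Observability

theorem IsObservable.ker_observabilityMatrix {ι : Type*} {n : ℕ} {C : Matrix ι (Fin n) ℝ}
    {A : Matrix (Fin n) (Fin n) ℝ} (h : IsObservable C A) :
    LinearMap.ker (observabilityMatrix C A).mulVecLin = ⊥ := by
  have hrank := LinearMap.finrank_range_add_finrank_ker (observabilityMatrix C A).mulVecLin
  have hrange : Module.finrank ℝ (LinearMap.range (observabilityMatrix C A).mulVecLin) = n := h
  rw [hrange, Module.finrank_fin_fun] at hrank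
  exact Submodule.finrank_eq_zero.1 (by omega)

theorem ker_observabilityMatrix_stackedOutput {N n : ℕ} {m : Fin N → ℕ}
    (C : ∀ i, Matrix (Fin (m i)) (Fin n) ℝ) (A : Matrix (Fin n) (Fin n) ℝ) :
    LinearMap.ker (observabilityMatrix (stackedOutput C) A).mulVecLin =
      ⨅ i, LinearMap.ker (observabilityMatrix (C i) A).mulVecLin := by
  ext w
  simp only [Submodule.mem_iInf, LinearMap.mem_ker, funext_iff, Prod.forall, Sigma.forall]
  exact ⟨fun h i k l => h k i l, fun h k i l => h i k l⟩

theorem IsUnobservableBasis.mulVec_injective {m n ν : ℕ} {C : Matrix (Fin m) (Fin n) ℝ}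
    {A : Matrix (Fin n) (Fin n) ℝ} {U : Matrix (Fin n) (Fin ν) ℝ}
    (hU : IsUnobservableBasis C A U) : Function.Injective U.mulVec :=
  Function.LeftInverse.injective (g := Uᵀ.mulVec) fun x => by
    rw [Matrix.mulVec_mulVec, hU.1, Matrix.one_mulVec]

theorem iInf_range_mulVecLin_eq_bot {N n : ℕ} {m ν : Fin N → ℕ} {A : Matrix (Fin n) (Fin n) ℝ}
    {C : ∀ i, Matrix (Fin (m i)) (Fin n) ℝ} (hobs : IsObservable (stackedOutput C) A)
    {U : ∀ i, Matrix (Fin n) (Fin (ν i)) ℝ} (hU : ∀ i, IsUnobservableBasis (C i) A (U i)) :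
    ⨅ i, LinearMap.range (U i).mulVecLin = ⊥ := by
  simp only [(hU _).2]
  rw [← ker_observabilityMatrix_stackedOutput, hobs.ker_observabilityMatrix]

end Observability

theorem lemma2_general {N n n₀ : ℕ} {ν : Fin N → ℕ}
    (G : Fin n₀ → SimpleGraph (Fin N))
    (a : Fin n₀ → Matrix (Fin N) (Fin N) ℝ)
    (ha : ∀ p, IsWeightedAdjacency (G p) (a p))
    (σ : ℝ → Fin n₀) (t : ℕ → ℝ) (τ : ℝ)
    (hσ : IsSwitchingSignal σ t τ)
    (hconn : JointlyConnected G σ t τ)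
    (U : ∀ i, Matrix (Fin n) (Fin (ν i)) ℝ)
    (hinj : ∀ i, Function.Injective (U i).mulVec)
    (hinf : ⨅ i, LinearMap.range (U i).mulVecLin = ⊥)
    (Q : Matrix (Σ i, Fin (ν i)) (Σ i, Fin (ν i)) ℝ)
    (hQ : Q.PosDef) :
    ExponentiallyStable fun s =>
      -(Q * (blockDiag U)ᵀ *
        (weightedLaplacian (a (σ s)) ⊗ₖ (1 : Matrix (Fin n) (Fin n) ℝ)) * blockDiag U) := by
  obtain ⟨j, T, hj, hj0, -, hwindow⟩ := hconn
  have hL : ∀ p, (weightedLaplacian (a p) ⊗ₖ (1 : Matrix (Fin n) (Fin n) ℝ)).PosSemidef :=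
    fun p => (ha p).posSemidef_weightedLaplacian.kronecker Matrix.PosSemidef.one
  simp only [Matrix.mul_assoc Q]
  refine hσ.exponentiallyStable_neg_mul hQ
    (H := fun p => (blockDiag U)ᴴ * (weightedLaplacian (a p) ⊗ₖ 1) * blockDiag U)
    (fun p => (hL p).conjTranspose_mul_mul_same _) hj hj0 (fun k => (hwindow k).2.1)
    fun k x hx => ?_
  refine eq_zero_of_weightedLaplacian_mulVec_blockDiag (fun r => ha (σ (t r))) (hwindow k).2.2
    hinj hinf fun r hr => mulVec_mulVec_eq_zero_of_posSemidef (hL _) (hx r ?_)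
  exact Finset.mem_Ico.2 ⟨hσ.strictMono.le_iff_le.1 hr.1, hσ.strictMono.lt_iff_lt.1 hr.2⟩

theorem lemma2 {N n n₀ : ℕ} {m ν : Fin N → ℕ}
    (A : Matrix (Fin n) (Fin n) ℝ)
    (C : ∀ i, Matrix (Fin (m i)) (Fin n) ℝ)
    (hobs : IsObservable (stackedOutput C) A)
    (G : Fin n₀ → SimpleGraph (Fin N))
    (a : Fin n₀ → Matrix (Fin N) (Fin N) ℝ)
    (ha : ∀ p, IsWeightedAdjacency (G p) (a p))
    (σ : ℝ → Fin n₀) (t : ℕ → ℝ) (τ : ℝ)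
    (hσ : IsSwitchingSignal σ t τ)
    (hconn : JointlyConnected G σ t τ)
    (U : ∀ i, Matrix (Fin n) (Fin (ν i)) ℝ)
    (hU : ∀ i, IsUnobservableBasis (C i) A (U i))
    (Q : Matrix (Σ i, Fin (ν i)) (Σ i, Fin (ν i)) ℝ)
    (hQ : Q.PosDef) :
    ExponentiallyStable fun s =>
      -(Q * (blockDiag U)ᵀ *
        (weightedLaplacian (a (σ s)) ⊗ₖ (1 : Matrix (Fin n) (Fin n) ℝ)) * blockDiag U) := by
  exact lemma2_general G a ha σ t τ hσ hconn U (fun i => (hU i).mulVec_injective)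
    (iInf_range_mulVecLin_eq_bot hobs hU) Q hQ
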